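/- All vector spaces and algebras are over $\mathbb{C}$. A *quasi \*-algebra* $(\mathfrak{A},\mathfrak{A}_0)$ is a vector space $\mathfrak{A}$ containing a \*-algebra $\mathfrak{A}_0$ as a subspace, together with bilinear products $ax, xa\in\mathfrak{A}$ ($a\in\mathfrak{A}$, $x\in\mathfrak{A}_0$) extending the product of $\mathfrak{A}_0$ and satisfying $(xa)y=x(ay)$, $a(xy)=(ax)y$, and an involution of $\mathfrak{A}$ extending that of $\mathfrak{A}_0$ with $(ax)^*=x^*a^*$, $(xa)^*=a^*x^*$. It is *unital* if there is $e\in\mathfrak{A}_0$ with $ae=a=ea$ for all $a\in\mathfrak{A}$. It is a *Banach quasi \*-algebra* if $\mathfrak{A}$ carries a complete norm such that $\|a^*\|=\|a\|$ for all $a$, $\mathfrak{A}_0$ is dense in $\mathfrak{A}$, and $a\mapsto ax$ is continuous for every $x\in\mathfrak{A}_0$. For a dense subspace $\mathcal{D}$ of a Hilbert space $\mathcal{H}$, let $\mathcal{L}^\dagger(\mathcal{D},\mathcal{H})$ be the space of linear operators $T:\mathcal{D}\to\mathcal{H}$ such that the domain $D(T^*)$ of the adjoint contains $\mathcal{D}$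 (such operators are closable), with $T^\dagger:=T^*|_{\mathcal{D}}$ and with the topology $\tau_{s^*}$ given by the seminorms $T\mapsto\max\{\|T\xi\|,\|T^\dagger\xi\|\}$, $\xi\in\mathcal{D}$. The weak product $T\,\square\,S:=(T^\dagger)^*S$ is defined when $S\mathcal{D}\subseteq D((T^\dagger)^*)$ and $T^\dagger\mathcal{D}\subseteq D(S^*)$. A *\*-representation* of $(\mathfrak{A},\mathfrak{A}_0)$ is a linear map $\pi:\mathfrak{A}\to\mathcal{L}^\dagger(\mathcal{D},\mathcal{H})$, for some such $\mathcal{D}\subseteq\mathcal{H}$, with $\pi(a^*)=\pi(a)^\dagger$ for all $a\in\mathfrak{A}$, with $\pi(a)\,\square\,\pi(x)$ defined and equal to $\pi(ax)$ for all $a\in\mathfrak{A}$, $x\in\mathfrak{A}_0$, and with $\pi(e)=I_{\mathcal{D}}$ if there is a unit $e$. It is *faithful* if $\pi(a)\neq0$ whenever $a\neq0$. **Theorem.** Let $(\mathfrak{A}[\|\cdot\|_{\mathfrak{A}}],\mathfrak{A}_0)$ and $(\mathfrak{B}[\|\cdot\|_{\mathfrak{B}}],\mathfrak{B}_0)$ be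 nonzero unital Banach quasi \*-algebras. Let $(\mathfrak{A}\otimes\mathfrak{B},\mathfrak{A}_0\otimes\mathfrak{B}_0)$ be their algebraic tensor product quasi \*-algebra, with $(a\otimes b)(x\otimes y)=ax\otimes by$, $(x\otimes y)(a\otimes b)=xa\otimes yb$ and $(a\otimes b)^*=a^*\otimes b^*$. Let $\bar n$ be a uniform cross-norm on $\mathfrak{A}\otimes\mathfrak{B}$, that is, a norm with $\|a\otimes b\|_{\bar n}=\|a\|_{\mathfrak{A}}\|b\|_{\mathfrak{B}}$ for all $a,b$ and such that, for all bounded linear operators $T_1$ on $\mathfrak{A}$ and $T_2$ on $\mathfrak{B}$, the operator $T_1\otimes T_2$ is $\|\cdot\|_{\bar n}$-bounded with norm at most $\|T_1\|\,\|T_2\|$. Write $\mathfrak{A}\otimes_{\bar n}\mathfrak{B}$ for $\mathfrak{A}\otimes\mathfrak{B}$ with the norm $\|\cdot\|_{\bar n}$ (not completed). Consider the statements: 1. there is a faithful $(\|\cdot\|_{\bar n}\text{-}\tau_{s^*})$-continuous \*-representation of $(\mathfrak{A}\otimes_{\bar n}\mathfrak{B},\mathfrak{A}_0\otimes\mathfrak{B}_0)$;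 2. there are a faithful $(\|\cdot\|_{\mathfrak{A}}\text{-}\tau_{s^*})$-continuous \*-representation of $(\mathfrak{A},\mathfrak{A}_0)$ and a faithful $(\|\cdot\|_{\mathfrak{B}}\text{-}\tau_{s^*})$-continuous \*-representation of $(\mathfrak{B},\mathfrak{B}_0)$. Then (1) implies (2). If moreover the normed space $\mathfrak{A}\otimes_{\bar n}\mathfrak{B}$ is barrelled, then (2) implies (1). -/

import Mathlib

open scoped TensorProduct InnerProductSpace

universe u v w u₀ v₀

/-- A quasi *-algebra `(A, A₀)`. The *-algebra `A₀` is identified with a subspace of the complex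
vector space with involution `A` through the injective linear map `incl`. For `x : A₀` and `a : A`,
`lmul x a` is the product `x a` and `rmul a x` is the product `a x`; both extend the product of
`A₀`. -/
structure QuasiStarAlgebra (A : Type u) (A₀ : Type u₀)
    [AddCommGroup A] [Module ℂ A] [StarAddMonoid A] [StarModule ℂ A]
    [NonUnitalRing A₀] [Module ℂ A₀] [IsScalarTower ℂ A₀ A₀] [SMulCommClass ℂ A₀ A₀]
    [StarRing A₀] [StarModule ℂ A₀] where
  incl : A₀ →ₗ[ℂ] A
  incl_injective : Function.Injective incl
  lmul : A₀ →ₗ[ℂ] A →ₗ[ℂ] A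
  rmul : A →ₗ[ℂ] A₀ →ₗ[ℂ] A
  lmul_incl : ∀ x y : A₀, lmul x (incl y) = incl (x * y)
  rmul_incl : ∀ x y : A₀, rmul (incl x) y = incl (x * y)
  /-- `(x a) y = x (a y)` -/
  lmul_rmul : ∀ (x y : A₀) (a : A), rmul (lmul x a) y = lmul x (rmul a y)
  /-- `a (x y) = (a x) y` -/
  rmul_mul : ∀ (x y : A₀) (a : A), rmul a (x * y) = rmul (rmul a x) y
  star_incl : ∀ x : A₀, star (incl x) = incl (star x)
  /-- `(a x)* = x* a*` -/
  star_rmul : ∀ (a : A) (x : A₀), star (rmul a x) = lmul (star x) (star a)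
  /-- `(x a)* = a* x*` -/
  star_lmul : ∀ (a : A) (x : A₀), star (lmul x a) = rmul (star a) (star x)

namespace QuasiStarAlgebra

section Basic

variable {A : Type u} {A₀ : Type u₀}
  [AddCommGroup A] [Module ℂ A] [StarAddMonoid A] [StarModule ℂ A]
  [NonUnitalRing A₀] [Module ℂ A₀] [IsScalarTower ℂ A₀ A₀] [SMulCommClass ℂ A₀ A₀]
  [StarRing A₀] [StarModule ℂ A₀]

/-- `e : A₀` is an identity of the quasi *-algebra: `a e = a = e a` for all `a : A`. -/
def IsIdentity (Q : QuasiStarAlgebra A A₀) (e : A₀) : Prop :=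
  ∀ a : A, Q.rmul a e = a ∧ Q.lmul e a = a

/-- The quasi *-algebra has a (necessarily unique) identity, lying in `A₀`. -/
def IsUnital (Q : QuasiStarAlgebra A A₀) : Prop :=
  ∃! e : A₀, Q.IsIdentity e

end Basic

section Normed

variable {A : Type u} {A₀ : Type u₀}
  [NormedAddCommGroup A] [NormedSpace ℂ A] [StarAddMonoid A] [StarModule ℂ A]
  [NonUnitalRing A₀] [Module ℂ A₀] [IsScalarTower ℂ A₀ A₀] [SMulCommClass ℂ A₀ A₀]
  [StarRing A₀] [StarModule ℂ A₀]

/-- Normed quasi *-algebra: the involution is isometric, `A₀` is dense in `A`, and right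
multiplication by each `x : A₀` is continuous. -/
structure IsNormed (Q : QuasiStarAlgebra A A₀) : Prop where
  norm_star : ∀ a : A, ‖star a‖ = ‖a‖
  dense : DenseRange Q.incl
  continuous_rmul : ∀ x : A₀, Continuous fun a : A => Q.rmul a x

/-- Banach quasi *-algebra: a normed quasi *-algebra `(A, A₀)` with `A` complete. -/
structure IsBanach (Q : QuasiStarAlgebra A A₀) : Prop extends Q.IsNormed where
  complete : CompleteSpace A

end Normed

section Tensor

variable {A : Type u} {A₀ : Type u₀}
  [AddCommGroup A] [Module ℂ A] [StarAddMonoid A] [StarModule ℂ A]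
  [NonUnitalRing A₀] [Module ℂ A₀] [IsScalarTower ℂ A₀ A₀] [SMulCommClass ℂ A₀ A₀]
  [StarRing A₀] [StarModule ℂ A₀]
  {B : Type v} {B₀ : Type v₀}
  [AddCommGroup B] [Module ℂ B] [StarAddMonoid B] [StarModule ℂ B]
  [NonUnitalRing B₀] [Module ℂ B₀] [IsScalarTower ℂ B₀ B₀] [SMulCommClass ℂ B₀ B₀]
  [StarRing B₀] [StarModule ℂ B₀]

/-- The *-algebra structure of `A₀ ⊗ B₀`: the product `(x ⊗ y)(x' ⊗ y') = x x' ⊗ y y'` and the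
involution `(x ⊗ y)* = x* ⊗ y*` are compatible. -/
noncomputable instance instStarRingTensor : StarRing (A₀ ⊗[ℂ] B₀) where
  star_mul s t := by
    induction s using TensorProduct.induction_on with
    | zero => simp
    | add s₁ s₂ h₁ h₂ => rw [add_mul, star_add, h₁, h₂, star_add, mul_add]
    | tmul x y =>
      induction t using TensorProduct.induction_on with
      | zero => simp
      | add t₁ t₂ h₁ h₂ => rw [mul_add, star_add, h₁, h₂, star_add, add_mul]
      | tmul x' y' => simp [Algebra.TensorProduct.tmul_mul_tmul]
  star_add := star_add

/-- The tensor product quasi *-algebra `(A ⊗ B, A₀ ⊗ B₀)`, with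
`(x ⊗ y)(a ⊗ b) = x a ⊗ y b`, `(a ⊗ b)(x ⊗ y) = a x ⊗ b y` and `(a ⊗ b)* = a* ⊗ b*`. -/
noncomputable def tensor (Q : QuasiStarAlgebra A A₀) (R : QuasiStarAlgebra B B₀) :
    QuasiStarAlgebra (A ⊗[ℂ] B) (A₀ ⊗[ℂ] B₀) where
  incl := TensorProduct.map Q.incl R.incl
  incl_injective := TensorProduct.map_injective_of_flat_flat _ _ Q.incl_injective R.incl_injective
  lmul := TensorProduct.map₂ Q.lmul R.lmul
  rmul := TensorProduct.map₂ Q.rmul R.rmul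
  lmul_incl s t := by
    induction s using TensorProduct.induction_on with
    | zero => simp
    | add s₁ s₂ h₁ h₂ => simp only [add_mul, map_add, LinearMap.add_apply, h₁, h₂]
    | tmul x y =>
      induction t using TensorProduct.induction_on with
      | zero => simp
      | add t₁ t₂ h₁ h₂ => simp only [mul_add, map_add, h₁, h₂]
      | tmul x' y' => simp [Algebra.TensorProduct.tmul_mul_tmul, Q.lmul_incl, R.lmul_incl]
  rmul_incl s t := by
    induction s using TensorProduct.induction_on with
    | zero => simp
    | add s₁ s₂ h₁ h₂ => simp only [add_mul, map_add, LinearMap.add_apply, h₁, h₂]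
    | tmul x y =>
      induction t using TensorProduct.induction_on with
      | zero => simp
      | add t₁ t₂ h₁ h₂ => simp only [mul_add, map_add, h₁, h₂]
      | tmul x' y' => simp [Algebra.TensorProduct.tmul_mul_tmul, Q.rmul_incl, R.rmul_incl]
  lmul_rmul s t c := by
    induction s using TensorProduct.induction_on with
    | zero => simp
    | add s₁ s₂ h₁ h₂ => simp only [map_add, LinearMap.add_apply, h₁, h₂]
    | tmul x y =>
      induction t using TensorProduct.induction_on with
      | zero => simp
      | add t₁ t₂ h₁ h₂ => simp only [map_add, h₁, h₂]
      | tmul x' y' =>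
        induction c using TensorProduct.induction_on with
        | zero => simp
        | add c₁ c₂ h₁ h₂ => simp only [map_add, LinearMap.add_apply, h₁, h₂]
        | tmul a b => simp [Q.lmul_rmul, R.lmul_rmul]
  rmul_mul s t c := by
    induction s using TensorProduct.induction_on with
    | zero => simp
    | add s₁ s₂ h₁ h₂ => simp only [add_mul, map_add, LinearMap.add_apply, h₁, h₂]
    | tmul x y =>
      induction t using TensorProduct.induction_on with
      | zero => simp
      | add t₁ t₂ h₁ h₂ => simp only [mul_add, map_add, h₁, h₂]
      | tmul x' y' =>
        induction c using TensorProduct.induction_on with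
        | zero => simp
        | add c₁ c₂ h₁ h₂ => simp only [map_add, LinearMap.add_apply, h₁, h₂]
        | tmul a b =>
          simp [Algebra.TensorProduct.tmul_mul_tmul, Q.rmul_mul, R.rmul_mul]
  star_incl s := by
    induction s using TensorProduct.induction_on with
    | zero => simp
    | add s₁ s₂ h₁ h₂ => simp only [map_add, star_add, h₁, h₂]
    | tmul x y => simp [Q.star_incl, R.star_incl]
  star_rmul c s := by
    induction s using TensorProduct.induction_on with
    | zero => simp
    | add s₁ s₂ h₁ h₂ => simp only [map_add, star_add, LinearMap.add_apply, h₁, h₂]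
    | tmul x y =>
      induction c using TensorProduct.induction_on with
      | zero => simp
      | add c₁ c₂ h₁ h₂ => simp only [map_add, star_add, LinearMap.add_apply, h₁, h₂]
      | tmul a b => simp [Q.star_rmul, R.star_rmul]
  star_lmul c s := by
    induction s using TensorProduct.induction_on with
    | zero => simp
    | add s₁ s₂ h₁ h₂ => simp only [map_add, star_add, LinearMap.add_apply, h₁, h₂]
    | tmul x y =>
      induction c using TensorProduct.induction_on with
      | zero => simp
      | add c₁ c₂ h₁ h₂ => simp only [map_add, star_add, LinearMap.add_apply, h₁, h₂]
      | tmul a b => simp [Q.star_lmul, R.star_lmul]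

end Tensor

end QuasiStarAlgebra

/-- The topology of a (semi)normed space, for a (semi)norm given as a function. -/
@[reducible]
noncomputable def Seminorm.normTopology {E : Type u} [AddCommGroup E] [Module ℂ E]
    (p : Seminorm ℂ E) : TopologicalSpace E :=
  p.toAddGroupSeminorm.toSeminormedAddCommGroup.toPseudoMetricSpace.toUniformSpace.toTopologicalSpace

/-- For the norm of a normed space this is its usual topology. -/
theorem normSeminorm_normTopology (E : Type u) [i : NormedAddCommGroup E] [NormedSpace ℂ E] :
    (normSeminorm ℂ E).normTopology =
      i.toPseudoMetricSpace.toUniformSpace.toTopologicalSpace := by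
  refine TopologicalSpace.ext_nhds fun x => ?_
  have h₁ := @Metric.nhds_basis_ball E
    (normSeminorm ℂ E).toAddGroupSeminorm.toSeminormedAddCommGroup.toPseudoMetricSpace x
  have h₂ := @Metric.nhds_basis_ball E i.toPseudoMetricSpace x
  refine h₁.eq_of_same_basis (h₂.congr (fun _ => Iff.rfl) fun r _ => ?_)
  have hd : ∀ y : E, @dist E (normSeminorm ℂ E).toAddGroupSeminorm.toSeminormedAddCommGroup.toDist
      y x = ‖y - x‖ := fun y =>
    @dist_eq_norm E (normSeminorm ℂ E).toAddGroupSeminorm.toSeminormedAddCommGroup y x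
  ext y
  change dist y x < r ↔
    @dist E (normSeminorm ℂ E).toAddGroupSeminorm.toSeminormedAddCommGroup.toDist y x < r
  rw [hd, dist_eq_norm]

/-- `n` is a uniform cross-norm on `A ⊗ B`: it is a norm with `n (a ⊗ b) = ‖a‖ ‖b‖`, and for all
bounded operators `T₁` on `A` and `T₂` on `B` the operator `T₁ ⊗ T₂` is bounded on `(A ⊗ B, n)`,
with norm at most `‖T₁‖ ‖T₂‖`. (The extension of `T₁ ⊗ T₂` to the completion has the same norm.) -/
structure IsUniformCrossNorm {A : Type u} {B : Type v}
    [NormedAddCommGroup A] [NormedSpace ℂ A] [NormedAddCommGroup B] [NormedSpace ℂ B]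
    (n : Seminorm ℂ (A ⊗[ℂ] B)) : Prop where
  definite : ∀ c : A ⊗[ℂ] B, n c = 0 → c = 0
  cross : ∀ (a : A) (b : B), n (a ⊗ₜ[ℂ] b) = ‖a‖ * ‖b‖
  uniform : ∀ (T₁ : A →L[ℂ] A) (T₂ : B →L[ℂ] B) (c : A ⊗[ℂ] B),
    n (TensorProduct.map (T₁ : A →ₗ[ℂ] A) (T₂ : B →ₗ[ℂ] B) c) ≤ ‖T₁‖ * ‖T₂‖ * n c

section LDag

variable {H : Type w} [NormedAddCommGroup H] [InnerProductSpace ℂ H] [CompleteSpace H]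

/-- The adjoint `T*` of an operator `T` with domain `D`. -/
noncomputable def opAdjoint {D : Submodule ℂ H} (T : D →ₗ[ℂ] H) : H →ₗ.[ℂ] H :=
  LinearPMap.adjoint (LinearPMap.mk D T)

/-- `L†(D, H)`: the operators `T : D → H` such that the domain of `T*` contains `D`. For `D` dense
such operators are automatically closable. -/
noncomputable def LDag (D : Submodule ℂ H) : Submodule ℂ (D →ₗ[ℂ] H) where
  carrier := {T | D ≤ (opAdjoint T).domain}
  zero_mem' := fun y _ => by
    refine (LinearPMap.mem_adjoint_domain_iff _ y).2 ?_
    have : (innerₛₗ ℂ y).comp (0 : D →ₗ[ℂ] H) = 0 := by ext; simp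
    exact (continuous_const : Continuous fun _ : D => (0 : ℂ)).congr fun x => by simp
  add_mem' := fun {S T} hS hT y hy => by
    refine (LinearPMap.mem_adjoint_domain_iff _ y).2 ?_
    have h₁ := (LinearPMap.mem_adjoint_domain_iff _ y).1 (hS hy)
    have h₂ := (LinearPMap.mem_adjoint_domain_iff _ y).1 (hT hy)
    exact (h₁.add h₂).congr fun x => (inner_add_right y (S x) (T x)).symm
  smul_mem' := fun c T hT y hy => by
    refine (LinearPMap.mem_adjoint_domain_iff _ y).2 ?_
    have h := (LinearPMap.mem_adjoint_domain_iff _ y).1 (hT hy)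
    exact (h.const_smul c).congr fun x => (inner_smul_right y (T x) c).symm

namespace LDag

variable {D : Submodule ℂ H}

/-- The restriction of `T*` to `D`, as a linear map. -/
noncomputable def adjointRestrict (T : LDag D) : D →ₗ[ℂ] H :=
  (opAdjoint T.1).toFun.comp (Submodule.inclusion T.2)

theorem inner_adjointRestrict (hD : Dense (D : Set H)) (T : LDag D) (η ξ : D) :
    ⟪adjointRestrict T η, (ξ : H)⟫_ℂ = ⟪(η : H), T.1 ξ⟫_ℂ :=
  LinearPMap.adjoint_isFormalAdjoint (T := LinearPMap.mk D T.1) hD ⟨η, T.2 η.2⟩ ξ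

/-- The involution `T† = T*` restricted to `D`. -/
noncomputable def dag (hD : Dense (D : Set H)) (T : LDag D) : LDag D :=
  ⟨adjointRestrict T, fun η hη =>
    LinearPMap.mem_adjoint_domain_of_exists (T := LinearPMap.mk D (adjointRestrict T)) η
      ⟨T.1 ⟨η, hη⟩, fun ξ => by
        have h := inner_adjointRestrict hD T ξ ⟨η, hη⟩
        rw [← inner_conj_symm, ← h, inner_conj_symm]
        rfl⟩⟩

theorem inner_dag (hD : Dense (D : Set H)) (T : LDag D) (η ξ : D) :
    ⟪(dag hD T).1 η, (ξ : H)⟫_ℂ = ⟪(η : H), T.1 ξ⟫_ℂ :=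
  inner_adjointRestrict hD T η ξ

theorem dag_add (hD : Dense (D : Set H)) (S T : LDag D) : dag hD (S + T) = dag hD S + dag hD T := by
  refine Subtype.ext (LinearMap.ext fun η => hD.eq_of_inner_left (𝕜 := ℂ) fun ξ hξ => ?_)
  have h := inner_dag hD (S + T) η ⟨ξ, hξ⟩
  have h₁ := inner_dag hD S η ⟨ξ, hξ⟩
  have h₂ := inner_dag hD T η ⟨ξ, hξ⟩
  simp only [Submodule.coe_add, LinearMap.add_apply, inner_add_left, inner_add_right] at *
  rw [h, h₁, h₂]

theorem dag_smul (hD : Dense (D : Set H)) (c : ℂ) (T : LDag D) :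
    dag hD (c • T) = (starRingEnd ℂ c) • dag hD T := by
  refine Subtype.ext (LinearMap.ext fun η => hD.eq_of_inner_left (𝕜 := ℂ) fun ξ hξ => ?_)
  have h := inner_dag hD (c • T) η ⟨ξ, hξ⟩
  have h₁ := inner_dag hD T η ⟨ξ, hξ⟩
  simp only [Submodule.coe_smul, LinearMap.smul_apply, inner_smul_left, inner_smul_right,
    Complex.conj_conj] at *
  rw [h, h₁]

/-- The seminorms `p*_ξ (T) = max {‖T ξ‖, ‖T† ξ‖}`, `ξ ∈ D`. -/
noncomputable def strongStarSeminorms (hD : Dense (D : Set H)) :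
    SeminormFamily ℂ (LDag D) D := fun ξ =>
  Seminorm.of (fun T => max ‖T.1 ξ‖ ‖(dag hD T).1 ξ‖)
    (fun S T => by
      rw [dag_add]
      exact max_le
        ((norm_add_le _ _).trans (add_le_add (le_max_left _ _) (le_max_left _ _)))
        ((norm_add_le _ _).trans (add_le_add (le_max_right _ _) (le_max_right _ _))))
    (fun c T => by
      rw [dag_smul]
      simp [norm_smul, mul_max_of_nonneg])

/-- The strong* topology `τ_{s*}` on `L†(D, H)`. -/
@[reducible]
noncomputable def strongStarTopology (hD : Dense (D : Set H)) : TopologicalSpace (LDag D) :=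
  (strongStarSeminorms hD).moduleFilterBasis.topology

/-- `T` is a left multiplier of `S`, i.e. the weak product `T □ S = (T†)* S` is defined:
`S D ⊆ D((T†)*)` and `T† D ⊆ D(S*)`. -/
def IsLeftMultiplier (hD : Dense (D : Set H)) (T S : LDag D) : Prop :=
  (∀ ξ : D, S.1 ξ ∈ (opAdjoint (dag hD T).1).domain) ∧
    ∀ ξ : D, (dag hD T).1 ξ ∈ (opAdjoint S.1).domain

/-- The weak product `T □ S = (T†)* S`. -/
noncomputable def wmul (hD : Dense (D : Set H)) (T S : LDag D) (h : IsLeftMultiplier hD T S) :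
    D →ₗ[ℂ] H :=
  (opAdjoint (dag hD T).1).toFun.comp (S.1.codRestrict _ h.1)

end LDag

end LDag

namespace QuasiStarAlgebra

variable {A : Type u} {A₀ : Type u₀}
  [AddCommGroup A] [Module ℂ A] [StarAddMonoid A] [StarModule ℂ A]
  [NonUnitalRing A₀] [Module ℂ A₀] [IsScalarTower ℂ A₀ A₀] [SMulCommClass ℂ A₀ A₀]
  [StarRing A₀] [StarModule ℂ A₀]

/-- A *-representation of a quasi *-algebra `(A, A₀)` in the Hilbert space `H`: a dense subspace
`D` of `H` and a linear map `π : A → L†(D, H)` with `π (a*) = π (a)†` for all `a ∈ A`,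
`π (a) □ π (x) = π (a x)` for all `a ∈ A`, `x ∈ A₀`, and `π (e) = 1` on `D` if `(A, A₀)` has an
identity `e`. -/
structure StarRep (Q : QuasiStarAlgebra A A₀) (H : Type w)
    [NormedAddCommGroup H] [InnerProductSpace ℂ H] [CompleteSpace H] where
  D : Submodule ℂ H
  dense : Dense (D : Set H)
  π : A →ₗ[ℂ] LDag D
  map_star : ∀ a : A, π (star a) = LDag.dag dense (π a)
  map_mul : ∀ (a : A) (x : A₀), ∃ h : LDag.IsLeftMultiplier dense (π a) (π (Q.incl x)),
    LDag.wmul dense (π a) (π (Q.incl x)) h = (π (Q.rmul a x)).1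
  map_identity : ∀ e : A₀, Q.IsIdentity e → (π (Q.incl e)).1 = D.subtype

/-- A *-representation is faithful if `a ≠ 0` implies `π a ≠ 0`. -/
def StarRep.IsFaithful {Q : QuasiStarAlgebra A A₀} {H : Type w}
    [NormedAddCommGroup H] [InnerProductSpace ℂ H] [CompleteSpace H] (ρ : Q.StarRep H) : Prop :=
  ∀ a : A, a ≠ 0 → ρ.π a ≠ 0

/-- `(p - τ_{s*})`-continuity of a *-representation, for a norm `p` on `A`. -/
def StarRep.IsStrongStarContinuous {Q : QuasiStarAlgebra A A₀} {H : Type w}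
    [NormedAddCommGroup H] [InnerProductSpace ℂ H] [CompleteSpace H] (ρ : Q.StarRep H)
    (p : Seminorm ℂ A) : Prop :=
  @Continuous A (LDag ρ.D) p.normTopology (LDag.strongStarTopology ρ.dense) ρ.π

/-- There is a faithful `(p - τ_{s*})`-continuous *-representation of `(A, A₀)` in some Hilbert
space. -/
def HasFaithfulContinuousStarRep (Q : QuasiStarAlgebra A A₀) (p : Seminorm ℂ A) : Prop :=
  ∃ (H : Type w) (_ : NormedAddCommGroup H) (_ : InnerProductSpace ℂ H) (_ : CompleteSpace H)
    (ρ : Q.StarRep H), ρ.IsFaithful ∧ ρ.IsStrongStarContinuous p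

end QuasiStarAlgebra

/-! For (1) ⇒ (2), a representation of the tensor product is restricted along `a ↦ a ⊗ f` and `b ↦ e
⊗ b`, where `e` and `f` are the identities. These maps preserve the quasi *-algebra structure. The
cross-norm identity makes them bounded, and injective because `e` and `f` are nonzero.

For (2) ⇒ (1), let `c = a ⊗ b` act as `π(a) ⊗ π'(b)` on the algebraic tensor product of the domains,
inside the completed Hilbert tensor product. The algebraic axioms are identities between
sesquilinear forms, so they can be checked on elementary tensors
(`HasFaithfulContinuousStarRep.of_core`). Faithfulness holds because the functionals `⟪η, π(·) ξ⟫ ⊗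
⟪η', π'(·) ξ'⟫` separate points (`TensorProduct.eq_zero_of_separating`).

Continuity is the only analytic point. Uniformity of the norm bounds only the scalar coefficients of
the tensor representation (`IsUniformCrossNorm.exists_bound`). Barrelledness upgrades this weak
boundedness to boundedness of `c ↦ π(c) ξ` and `c ↦ π(c*) ξ`, by a uniform boundedness argument
(`exists_bound_of_barrelled`). -/

namespace LDag

/-! ### Operators in `L†(D, H)` recognised by their sesquilinear forms -/

variable {H : Type w} [NormedAddCommGroup H] [InnerProductSpace ℂ H] [CompleteSpace H]
  {D : Submodule ℂ H}

/-- `T†` is the only operator on `D` formally adjoint to `T`. -/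
theorem dag_eq_of_inner (hD : Dense (D : Set H)) {S T : LDag D}
    (h : ∀ η ξ : D, ⟪S.1 η, (ξ : H)⟫_ℂ = ⟪(η : H), T.1 ξ⟫_ℂ) : dag hD T = S := by
  refine Subtype.ext (LinearMap.ext fun η => hD.eq_of_inner_left (𝕜 := ℂ) fun ξ hξ => ?_)
  exact (inner_dag hD T η ⟨ξ, hξ⟩).trans (h η ⟨ξ, hξ⟩).symm

/-- An operator with a formal adjoint on `D` belongs to `L†(D, H)`. -/
theorem mem_of_inner {S T : D →ₗ[ℂ] H}
    (h : ∀ η ξ : D, ⟪S η, (ξ : H)⟫_ℂ = ⟪(η : H), T ξ⟫_ℂ) : T ∈ LDag D := fun η hη =>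
  LinearPMap.mem_adjoint_domain_of_exists (T := LinearPMap.mk D T) η ⟨S ⟨η, hη⟩, h ⟨η, hη⟩⟩

/-- The weak product `T □ S` is defined and equal to `P ∈ L†(D, H)` if the sesquilinear forms of
`T □ S` and of `P` coincide. -/
theorem exists_wmul_eq (hD : Dense (D : Set H)) {T S P : LDag D}
    (h : ∀ η ξ : D, ⟪(dag hD T).1 η, S.1 ξ⟫_ℂ = ⟪(η : H), P.1 ξ⟫_ℂ) :
    ∃ hm : IsLeftMultiplier hD T S, wmul hD T S hm = P.1 := by
  have h' : ∀ ξ η : D, ⟪P.1 ξ, (η : H)⟫_ℂ = ⟪S.1 ξ, (dag hD T).1 η⟫_ℂ := fun ξ η => by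
    rw [← inner_conj_symm, ← h η ξ, inner_conj_symm]
  refine ⟨⟨fun ξ => ?_, fun η => ?_⟩, LinearMap.ext fun ξ => ?_⟩
  · exact LinearPMap.mem_adjoint_domain_of_exists (T := LinearPMap.mk D (dag hD T).1) _
      ⟨P.1 ξ, fun η => h' ξ η⟩
  · exact LinearPMap.mem_adjoint_domain_of_exists (T := LinearPMap.mk D S.1) _
      -- The value of `S*` at `T† η` is `P† η`; this is where `P ∈ L†(D, H)`, and not merely `P : D
      -- → H`, is needed.
      ⟨(dag hD P).1 η, fun ξ => (inner_dag hD P η ξ).trans (h η ξ).symm⟩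
  · exact LinearPMap.adjoint_apply_eq (T := LinearPMap.mk D (dag hD T).1) hD _ (h' ξ)

end LDag

/-! ### Bounded seminorms and barrelled spaces -/

/-- A continuous seminorm is dominated by a multiple of the norm. -/
theorem Seminorm.exists_le_mul_of_continuous {E : Type u} [AddCommGroup E] [Module ℂ E]
    (p q : Seminorm ℂ E) (hq : @Continuous E ℝ p.normTopology _ q) :
    ∃ C : ℝ, 0 ≤ C ∧ ∀ x, q x ≤ C * p x := by
  let : SeminormedAddCommGroup E := p.toAddGroupSeminorm.toSeminormedAddCommGroup
  let : NormedSpace ℂ E := ⟨fun c x => (map_smul_eq_mul p c x).le⟩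
  obtain ⟨C, hC, h⟩ := Seminorm.bound_of_continuous_normedSpace q hq
  exact ⟨C, hC.le, h⟩

theorem Seminorm.continuous_of_le_mul {E : Type u} [AddCommGroup E] [Module ℂ E]
    (p q : Seminorm ℂ E) {C : ℝ} (h : ∀ x, q x ≤ C * p x) :
    @Continuous E ℝ p.normTopology _ q := by
  let : SeminormedAddCommGroup E := p.toAddGroupSeminorm.toSeminormedAddCommGroup
  let : NormedSpace ℂ E := ⟨fun c x => (map_smul_eq_mul p c x).le⟩
  have hb : ∀ x, q x ≤ (‖C‖₊ • normSeminorm ℂ E) x := fun x =>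
    (h x).trans (mul_le_mul_of_nonneg_right (le_abs_self C) (apply_nonneg p x))
  refine Seminorm.continuous_of_le (?_ : Continuous (‖C‖₊ • normSeminorm ℂ E)) hb
  exact continuous_norm.const_smul ‖C‖₊

/-- A semilinear map `T` from a barrelled space into a Hilbert space is bounded as soon as the
functionals `x ↦ ⟪η, T x⟫` are bounded for `η` in a dense set. -/
theorem exists_bound_of_barrelled {E : Type u} [AddCommGroup E] [Module ℂ E] (p : Seminorm ℂ E)
    (hE : @BarrelledSpace ℂ E _ _ _ p.normTopology)
    {F : Type w} [NormedAddCommGroup F] [InnerProductSpace ℂ F]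
    {σ : ℂ →+* ℂ} [RingHomIsometric σ] (T : E →ₛₗ[σ] F) {V : Set F} (hV : Dense V)
    (h : ∀ η ∈ V, ∃ C : ℝ, ∀ x, ‖⟪η, T x⟫_ℂ‖ ≤ C * p x) :
    ∃ C : ℝ, 0 ≤ C ∧ ∀ x, ‖T x‖ ≤ C * p x := by
  refine p.exists_le_mul_of_continuous ((normSeminorm ℂ F).comp T) ?_
  let := p.normTopology
  -- On a barrelled space a lower semicontinuous seminorm is continuous, so it remains to see that
  -- the sets `‖T x‖ ≤ r` are closed.
  refine hE.continuous_of_lowerSemicontinuous _ (lowerSemicontinuous_iff_isClosed_preimage.2 ?_)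
  intro r
  rcases lt_or_ge r 0 with hr | hr
  · convert isClosed_empty
    ext x
    simpa using hr.trans_le (norm_nonneg (T x))
  -- For `r ≥ 0` the condition `‖T x‖ ≤ r` can be tested against the vectors of `V`, which turns the
  -- sublevel set into an intersection of sets defined by the bounded functionals `⟪η, T ·⟫`.
  have hset : (fun x => ((normSeminorm ℂ F).comp T) x) ⁻¹' Set.Iic r =
      ⋂ η ∈ V, {x | ‖⟪η, T x⟫_ℂ‖ ≤ r * ‖η‖} := by
    ext x
    simp only [Set.mem_preimage, Seminorm.comp_apply, coe_normSeminorm, Set.mem_Iic,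
      Set.mem_iInter, Set.mem_ofPred_eq]
    constructor
    · intro hx η _
      rw [mul_comm]
      exact (norm_inner_le_norm η (T x)).trans (by gcongr)
    · intro hx
      have hall : ∀ η : F, ‖⟪η, T x⟫_ℂ‖ ≤ r * ‖η‖ := fun η =>
        hV.induction (P := fun η => ‖⟪η, T x⟫_ℂ‖ ≤ r * ‖η‖) hx
          (isClosed_le (by fun_prop) (by fun_prop)) η
      -- Testing against `η = T x` gives `‖T x‖² ≤ r ‖T x‖`.
      have hx2 := hall (T x)
      rw [inner_self_eq_norm_sq_to_K] at hx2
      rcases (norm_nonneg (T x)).eq_or_lt with h0 | h0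
      · rwa [← h0]
      · refine le_of_mul_le_mul_right ?_ h0
        simpa [sq] using hx2
  change IsClosed ((fun x => ((normSeminorm ℂ F).comp T) x) ⁻¹' Set.Iic r)
  rw [hset]
  refine isClosed_biInter fun η hη => ?_
  obtain ⟨C, hC⟩ := h η hη
  have hc : Continuous ((normSeminorm ℂ ℂ).comp ((innerₛₗ ℂ η).comp T)) :=
    p.continuous_of_le_mul _ (C := C) fun x => hC x
  exact isClosed_le hc continuous_const

/-! ### Identities, continuity criterion and construction of representations -/

namespace QuasiStarAlgebra

variable {A : Type u} {A₀ : Type u₀}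
  [AddCommGroup A] [Module ℂ A] [StarAddMonoid A] [StarModule ℂ A]
  [NonUnitalRing A₀] [Module ℂ A₀] [IsScalarTower ℂ A₀ A₀] [SMulCommClass ℂ A₀ A₀]
  [StarRing A₀] [StarModule ℂ A₀]
  {B : Type v} {B₀ : Type v₀}
  [AddCommGroup B] [Module ℂ B] [StarAddMonoid B] [StarModule ℂ B]
  [NonUnitalRing B₀] [Module ℂ B₀] [IsScalarTower ℂ B₀ B₀] [SMulCommClass ℂ B₀ B₀]
  [StarRing B₀] [StarModule ℂ B₀]

theorem IsIdentity.unique {Q : QuasiStarAlgebra A A₀} {e f : A₀} (he : Q.IsIdentity e)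
    (hf : Q.IsIdentity f) : e = f := by
  apply Q.incl_injective
  rw [← (hf (Q.incl e)).1, ← (he (Q.incl f)).2, Q.rmul_incl, Q.lmul_incl]

theorem IsIdentity.star_eq {Q : QuasiStarAlgebra A A₀} {e : A₀} (he : Q.IsIdentity e) :
    star e = e := by
  refine IsIdentity.unique (Q := Q) (fun a => ⟨?_, ?_⟩) he
  · rw [← star_star a, ← Q.star_lmul, (he _).2]
  · rw [← star_star a, ← Q.star_rmul, (he _).1]

theorem IsIdentity.tensor {Q : QuasiStarAlgebra A A₀} {R : QuasiStarAlgebra B B₀} {e : A₀} {f : B₀}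
    (he : Q.IsIdentity e) (hf : R.IsIdentity f) : (Q.tensor R).IsIdentity (e ⊗ₜ f) := by
  intro c
  induction c using TensorProduct.induction_on with
  | zero => simp
  | add c₁ c₂ h₁ h₂ => simp only [map_add, LinearMap.add_apply, h₁, h₂, and_self]
  | tmul a b => simp [QuasiStarAlgebra.tensor, (he a).1, (he a).2, (hf b).1, (hf b).2]

theorem IsIdentity.incl_ne_zero [Nontrivial A] {Q : QuasiStarAlgebra A A₀} {e : A₀}
    (he : Q.IsIdentity e) : Q.incl e ≠ 0 := by
  intro h
  obtain ⟨a, ha⟩ := exists_ne (0 : A)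
  have h0 : e = 0 := Q.incl_injective (h.trans (map_zero _).symm)
  exact ha (by rw [← (he a).1, h0, map_zero])

section Rep

variable {H : Type w} [NormedAddCommGroup H] [InnerProductSpace ℂ H] [CompleteSpace H]

/-- A *-representation is `(p - τ_{s*})`-continuous if and only if all the maps `a ↦ π (a) ξ` and
`a ↦ π (a*) ξ` are bounded. -/
theorem StarRep.isStrongStarContinuous_iff {Q : QuasiStarAlgebra A A₀} (ρ : Q.StarRep H)
    (p : Seminorm ℂ A) : ρ.IsStrongStarContinuous p ↔ ∀ ξ : ρ.D, ∃ C : ℝ, 0 ≤ C ∧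
      ∀ a, ‖(ρ.π a).1 ξ‖ ≤ C * p a ∧ ‖(ρ.π (star a)).1 ξ‖ ≤ C * p a := by
  let tA : SeminormedAddCommGroup A := p.toAddGroupSeminorm.toSeminormedAddCommGroup
  let : TopologicalSpace (LDag ρ.D) := LDag.strongStarTopology ρ.dense
  have hs : WithSeminorms (LDag.strongStarSeminorms ρ.dense) := ⟨rfl⟩
  have key : ∀ ξ a, (LDag.strongStarSeminorms ρ.dense ξ).comp ρ.π a =
      max ‖(ρ.π a).1 ξ‖ ‖(ρ.π (star a)).1 ξ‖ := fun ξ a => by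
    rw [ρ.map_star]; rfl
  refine (hs.continuous_iff_continuous_comp (E := A) ρ.π).trans (forall_congr' fun ξ => ?_)
  constructor
  · intro h
    obtain ⟨C, hC, hb⟩ := p.exists_le_mul_of_continuous _ h
    refine ⟨C, hC, fun a => ?_⟩
    have := hb a
    rwa [key, max_le_iff] at this
  · rintro ⟨C, -, hb⟩
    refine p.continuous_of_le_mul _ (C := C) fun a => ?_
    rw [key]
    exact max_le (hb a).1 (hb a).2

/-- Restriction of a *-representation along a morphism of quasi *-algebras. -/
noncomputable def StarRep.comp {Q : QuasiStarAlgebra A A₀} {R : QuasiStarAlgebra B B₀}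
    (ρ : R.StarRep H) (φ : A →ₗ[ℂ] B) (φ₀ : A₀ → B₀) (hstar : ∀ a, φ (star a) = star (φ a))
    (hincl : ∀ x, φ (Q.incl x) = R.incl (φ₀ x))
    (hmul : ∀ a x, φ (Q.rmul a x) = R.rmul (φ a) (φ₀ x))
    (hid : ∀ e, Q.IsIdentity e → R.IsIdentity (φ₀ e)) : Q.StarRep H where
  D := ρ.D
  dense := ρ.dense
  π := ρ.π.comp φ
  map_star a := by simp [hstar, ρ.map_star]
  map_mul a x := by
    simp only [LinearMap.comp_apply, hincl, hmul]
    exact ρ.map_mul (φ a) (φ₀ x)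
  map_identity e he := by
    simp only [LinearMap.comp_apply, hincl]
    exact ρ.map_identity _ (hid e he)

end Rep

/-- Pulling back along an injective bounded morphism preserves faithfulness and continuity. This is
the mechanism of (1) ⇒ (2). -/
theorem HasFaithfulContinuousStarRep.comp {Q : QuasiStarAlgebra A A₀} {R : QuasiStarAlgebra B B₀}
    {p : Seminorm ℂ A} {q : Seminorm ℂ B} (h : HasFaithfulContinuousStarRep.{v, w, v₀} R q)
    (φ : A →ₗ[ℂ] B) (φ₀ : A₀ → B₀) (hstar : ∀ a, φ (star a) = star (φ a))
    (hincl : ∀ x, φ (Q.incl x) = R.incl (φ₀ x))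
    (hmul : ∀ a x, φ (Q.rmul a x) = R.rmul (φ a) (φ₀ x))
    (hid : ∀ e, Q.IsIdentity e → R.IsIdentity (φ₀ e))
    (hinj : ∀ a, a ≠ 0 → φ a ≠ 0) {M : ℝ} (hb : ∀ a, q (φ a) ≤ M * p a) :
    HasFaithfulContinuousStarRep.{u, w, u₀} Q p := by
  obtain ⟨H, i₁, i₂, i₃, ρ, hf, hc⟩ := h
  refine ⟨H, i₁, i₂, i₃, ρ.comp φ φ₀ hstar hincl hmul hid, fun a ha => hf _ (hinj a ha),
    (StarRep.isStrongStarContinuous_iff _ _).2 fun ξ => ?_⟩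
  obtain ⟨C, hC, h⟩ := (ρ.isStrongStarContinuous_iff q).1 hc ξ
  -- The sign of `M` is not prescribed, hence the maximum with `0`.
  refine ⟨max (C * M) 0, le_max_right _ _, fun a => ?_⟩
  have hle : C * q (φ a) ≤ max (C * M) 0 * p a :=
    (mul_le_mul_of_nonneg_left (hb a) hC).trans (by
      rw [← mul_assoc]
      exact mul_le_mul_of_nonneg_right (le_max_left _ _) (apply_nonneg p a))
  refine ⟨(h (φ a)).1.trans hle, ?_⟩
  change ‖(ρ.π (φ (star a))).1 ξ‖ ≤ _
  rw [hstar]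
  exact (h (φ a)).2.trans hle

/-- Construction of a faithful continuous *-representation from its sesquilinear forms: `j` embeds
the vector space `V` as the domain, and `T` gives the operators. -/
theorem HasFaithfulContinuousStarRep.of_core (Q : QuasiStarAlgebra A A₀) (p : Seminorm ℂ A)
    {H : Type w} [NormedAddCommGroup H] [InnerProductSpace ℂ H] [CompleteSpace H]
    {V : Type*} [AddCommGroup V] [Module ℂ V] (j : V →ₗ[ℂ] H) (hj : Function.Injective j)
    (hd : DenseRange j) (T : A →ₗ[ℂ] V →ₗ[ℂ] H)
    (hstar : ∀ a η ξ, ⟪T (star a) η, j ξ⟫_ℂ = ⟪j η, T a ξ⟫_ℂ)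
    (hmul : ∀ a x η ξ, ⟪T (star a) η, T (Q.incl x) ξ⟫_ℂ = ⟪j η, T (Q.rmul a x) ξ⟫_ℂ)
    (hid : ∀ e, Q.IsIdentity e → T (Q.incl e) = j) (hf : ∀ a, T a = 0 → a = 0)
    (hb : ∀ ξ, ∃ C : ℝ, 0 ≤ C ∧ ∀ a, ‖T a ξ‖ ≤ C * p a ∧ ‖T (star a) ξ‖ ≤ C * p a) :
    HasFaithfulContinuousStarRep.{u, w, u₀} Q p := by
  let e : V ≃ₗ[ℂ] LinearMap.range j := LinearEquiv.ofInjective j hj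
  have hje : ∀ ξ : LinearMap.range j, j (e.symm ξ) = ξ := fun ξ =>
    congrArg Subtype.val (e.apply_symm_apply ξ)
  have hD : Dense (LinearMap.range j : Set H) := by
    rw [LinearMap.coe_range]; exact hd
  have hadj : ∀ a (η ξ : LinearMap.range j),
      ⟪T (star a) (e.symm η), (ξ : H)⟫_ℂ = ⟪(η : H), T a (e.symm ξ)⟫_ℂ := fun a η ξ => by
    have h := hstar a (e.symm η) (e.symm ξ)
    rwa [hje, hje] at h
  let P : A →ₗ[ℂ] LDag (LinearMap.range j) :=
    { toFun := fun a => ⟨(T a).comp e.symm.toLinearMap,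
        LDag.mem_of_inner (S := (T (star a)).comp e.symm.toLinearMap) (hadj a)⟩
      map_add' := fun a b => Subtype.ext (by simp [LinearMap.add_comp])
      map_smul' := fun c a => Subtype.ext (by simp [LinearMap.smul_comp]) }
  have hP : ∀ a ξ, (P a).1 ξ = T a (e.symm ξ) := fun _ _ => rfl
  have hPstar : ∀ a, LDag.dag hD (P a) = P (star a) := fun a => LDag.dag_eq_of_inner hD (hadj a)
  let ρ : Q.StarRep H :=
    { D := LinearMap.range j
      dense := hD
      π := P
      map_star := fun a => (hPstar a).symm
      map_mul := fun a x => LDag.exists_wmul_eq hD fun η ξ => by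
        rw [hPstar, hP, hP, hP, hmul, hje]
      map_identity := fun f hf => LinearMap.ext fun ξ => by
        rw [hP, hid f hf, hje]; rfl }
  refine ⟨H, _, _, _, ρ, fun a ha h0 => ha (hf a (LinearMap.ext fun v => ?_)),
    (ρ.isStrongStarContinuous_iff p).2 fun ξ => hb (e.symm ξ)⟩
  have h : (P a).1 (e v) = 0 := by rw [show P a = 0 from h0]; rfl
  rwa [hP, e.symm_apply_apply] at h

end QuasiStarAlgebra

/-! ### Functionals on tensor products, and density -/

theorem IsUniformCrossNorm.tmul_ne_zero {A : Type u} {B : Type v}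
    [NormedAddCommGroup A] [NormedSpace ℂ A] [NormedAddCommGroup B] [NormedSpace ℂ B]
    {n : Seminorm ℂ (A ⊗[ℂ] B)} (hn : IsUniformCrossNorm n) {a : A} {b : B} (ha : a ≠ 0)
    (hb : b ≠ 0) : a ⊗ₜ[ℂ] b ≠ 0 := fun h => by
  have := hn.cross a b
  rw [h, map_zero, eq_comm, mul_eq_zero, norm_eq_zero, norm_eq_zero] at this
  exact this.elim ha hb

/-- The tensor product of two bounded functionals is bounded for a uniform cross-norm. -/
theorem IsUniformCrossNorm.exists_bound {A : Type u} {B : Type v}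
    [NormedAddCommGroup A] [NormedSpace ℂ A] [NormedAddCommGroup B] [NormedSpace ℂ B]
    [Nontrivial A] [Nontrivial B] {n : Seminorm ℂ (A ⊗[ℂ] B)} (hn : IsUniformCrossNorm n)
    (f : A →L[ℂ] ℂ) (g : B →L[ℂ] ℂ) : ∃ C : ℝ, ∀ c,
      ‖LinearMap.mul' ℂ ℂ (TensorProduct.map f.toLinearMap g.toLinearMap c)‖ ≤ C * n c := by
  obtain ⟨a₀, ha₀⟩ := exists_ne (0 : A)
  obtain ⟨b₀, hb₀⟩ := exists_ne (0 : B)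
  have hpos : 0 < ‖a₀‖ * ‖b₀‖ := by positivity
  -- Uniformity concerns operators, so `f` and `g` are replaced by the rank-one operators `f(·) a₀`
  -- and `g(·) b₀`. Their tensor product is `(f ⊗ g)(·) a₀ ⊗ b₀`, and the cross-norm identity allows
  -- division by `‖a₀‖ ‖b₀‖`.
  refine ⟨‖f.smulRight a₀‖ * ‖g.smulRight b₀‖ / (‖a₀‖ * ‖b₀‖), fun c => ?_⟩
  have hmap : TensorProduct.map (f.smulRight a₀ : A →ₗ[ℂ] A) (g.smulRight b₀ : B →ₗ[ℂ] B) c =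
      LinearMap.mul' ℂ ℂ (TensorProduct.map f.toLinearMap g.toLinearMap c) • (a₀ ⊗ₜ[ℂ] b₀) := by
    induction c using TensorProduct.induction_on with
    | zero => simp
    | add c₁ c₂ h₁ h₂ => simp only [map_add, h₁, h₂, add_smul]
    | tmul a b => simp [← TensorProduct.smul_tmul', smul_smul, mul_comm]
  have h := hn.uniform (f.smulRight a₀) (g.smulRight b₀) c
  rw [hmap, map_smul_eq_mul, hn.cross] at h
  rw [div_mul_eq_mul_div, le_div_iff₀ hpos]
  exact h

/-- If `f` and `g` range over separating families of functionals, then the functionals `f ⊗ g`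
separate the points of the tensor product. -/
theorem TensorProduct.eq_zero_of_separating {A : Type u} {B : Type v}
    [AddCommGroup A] [Module ℂ A] [AddCommGroup B] [Module ℂ B] {ι κ : Type*}
    (f : ι → A →ₗ[ℂ] ℂ) (g : κ → B →ₗ[ℂ] ℂ) (hf : ∀ a, (∀ i, f i a = 0) → a = 0)
    (hg : ∀ b, (∀ k, g k b = 0) → b = 0) (c : A ⊗[ℂ] B)
    (hc : ∀ i k, LinearMap.mul' ℂ ℂ (TensorProduct.map (f i) (g k) c) = 0) : c = 0 := by
  classical
  let bB := Module.Basis.ofVectorSpace ℂ B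
  -- The slice `(f i ⊗ id) c ∈ B` is killed by every `g k`, hence vanishes.
  have h₁ : ∀ i, TensorProduct.lid ℂ B ((f i).rTensor B c) = 0 := fun i => hg _ fun k => by
    rw [← hc i k]
    clear hc
    induction c using TensorProduct.induction_on with
    | zero => simp
    | add c₁ c₂ h₁ h₂ => simp only [map_add, h₁, h₂]
    | tmul a b => simp
  -- Write `c = ∑ a_k ⊗ b_k` in the basis of `B`. The coordinates of the slice are the `f i (a_k)`,
  -- so each `a_k` is killed by all `f i`.
  have h₂ : ∀ i k, f i (TensorProduct.equivFinsuppOfBasisRight bB c k) = 0 := fun i k => by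
    have h : f i (TensorProduct.equivFinsuppOfBasisRight bB c k) =
        bB.repr (TensorProduct.lid ℂ B ((f i).rTensor B c)) k := by
      clear h₁ hc
      induction c using TensorProduct.induction_on with
      | zero => simp
      | add c₁ c₂ h₁ h₂ => simp only [map_add, Finsupp.add_apply, h₁, h₂]
      | tmul a b => simp [mul_comm]
    rw [h, h₁]; simp
  refine (TensorProduct.equivFinsuppOfBasisRight bB).map_eq_zero_iff.1 (Finsupp.ext fun k => ?_)
  exact hf _ fun i => h₂ i k

/-- The algebraic tensor product of dense subspaces is dense in the completed tensor product. -/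
theorem denseRange_toCompl_map_subtype {H : Type w} [NormedAddCommGroup H] [InnerProductSpace ℂ H]
    {K : Type w} [NormedAddCommGroup K] [InnerProductSpace ℂ K]
    {D : Submodule ℂ H} {E : Submodule ℂ K} (hD : Dense (D : Set H)) (hE : Dense (E : Set K)) :
    DenseRange (fun t : D ⊗[ℂ] E =>
      ((TensorProduct.map D.subtype E.subtype t : H ⊗[ℂ] K) :
        UniformSpace.Completion (H ⊗[ℂ] K))) := by
  refine (UniformSpace.Completion.denseRange_coe (α := H ⊗[ℂ] K)).comp ?_
    (UniformSpace.Completion.continuous_coe _)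
  -- The closure is a subspace, so it suffices to approximate elementary tensors, by continuity of
  -- `⊗`.
  let S : Submodule ℂ (H ⊗[ℂ] K) :=
    (LinearMap.range (TensorProduct.map D.subtype E.subtype)).topologicalClosure
  have hS : ∀ t, t ∈ S := fun t => by
    induction t using TensorProduct.induction_on with
    | zero => exact S.zero_mem
    | add s t hs ht => exact S.add_mem hs ht
    | tmul x y =>
      refine map_mem_closure₂ (f := fun (x : H) (y : K) => x ⊗ₜ[ℂ] y)
        TensorProduct.continuous_tmul (hD x) (hE y) ?_
      exact fun x hx y hy => ⟨(⟨x, hx⟩ : D) ⊗ₜ (⟨y, hy⟩ : E), by simp⟩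
  exact fun t => hS t

/-! ### The tensor product of two representations -/

namespace QuasiStarAlgebra

section Rep

variable {A : Type u} {A₀ : Type u₀}
  [AddCommGroup A] [Module ℂ A] [StarAddMonoid A] [StarModule ℂ A]
  [NonUnitalRing A₀] [Module ℂ A₀] [IsScalarTower ℂ A₀ A₀] [SMulCommClass ℂ A₀ A₀]
  [StarRing A₀] [StarModule ℂ A₀]
  {B : Type v} {B₀ : Type v₀}
  [AddCommGroup B] [Module ℂ B] [StarAddMonoid B] [StarModule ℂ B]
  [NonUnitalRing B₀] [Module ℂ B₀] [IsScalarTower ℂ B₀ B₀] [SMulCommClass ℂ B₀ B₀]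
  [StarRing B₀] [StarModule ℂ B₀]
  {Q : QuasiStarAlgebra A A₀} {R : QuasiStarAlgebra B B₀}
  {H : Type w} [NormedAddCommGroup H] [InnerProductSpace ℂ H] [CompleteSpace H]
  {K : Type w} [NormedAddCommGroup K] [InnerProductSpace ℂ K] [CompleteSpace K]

namespace StarRep

/-- A *-representation as a bilinear map `(a, ξ) ↦ π (a) ξ`. -/
noncomputable def op (ρ : Q.StarRep H) : A →ₗ[ℂ] ρ.D →ₗ[ℂ] H := (LDag ρ.D).subtype.comp ρ.π

theorem inner_op_star (ρ : Q.StarRep H) (a : A) (η ξ : ρ.D) :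
    ⟪ρ.op (star a) η, (ξ : H)⟫_ℂ = ⟪(η : H), ρ.op a ξ⟫_ℂ := by
  simp only [op, LinearMap.comp_apply, ρ.map_star]
  exact LDag.inner_dag ρ.dense _ _ _

/-- The weak product axiom in sesquilinear form, obtained by moving `(π(a)†)*` across the inner
product. Unlike the weak product itself, this form carries no domain conditions and passes to tensor
products. -/
theorem inner_op_star_op (ρ : Q.StarRep H) (a : A) (x : A₀) (η ξ : ρ.D) :
    ⟪ρ.op (star a) η, ρ.op (Q.incl x) ξ⟫_ℂ = ⟪(η : H), ρ.op (Q.rmul a x) ξ⟫_ℂ := by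
  obtain ⟨h, hm⟩ := ρ.map_mul a x
  simp only [op, LinearMap.comp_apply, Submodule.subtype_apply, ρ.map_star, ← hm]
  have := LinearPMap.adjoint_isFormalAdjoint
    (T := LinearPMap.mk ρ.D (LDag.dag ρ.dense (ρ.π a)).1) ρ.dense ⟨_, h.1 ξ⟩ η
  rw [← inner_conj_symm (η : H)]
  refine ((congrArg (starRingEnd ℂ) this).trans ?_).symm
  exact inner_conj_symm _ _

/-- The matrix coefficient `a ↦ ⟪η, π (a) ξ⟫`. -/
noncomputable def coeff (ρ : Q.StarRep H) (η ξ : ρ.D) : A →ₗ[ℂ] ℂ :=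
  (innerₛₗ ℂ (η : H)).comp (ρ.op.flip ξ)

theorem coeff_apply (ρ : Q.StarRep H) (η ξ : ρ.D) (a : A) :
    ρ.coeff η ξ a = ⟪(η : H), ρ.op a ξ⟫_ℂ := rfl

/-- By density of the domain, an operator on it with all coefficients zero is zero. -/
theorem IsFaithful.eq_zero_of_coeff {ρ : Q.StarRep H} (hρ : ρ.IsFaithful) (a : A)
    (h : ∀ i : ρ.D × ρ.D, ρ.coeff i.1 i.2 a = 0) : a = 0 := by
  by_contra ha
  refine hρ a ha (Subtype.ext (LinearMap.ext fun ξ => ?_))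
  exact ρ.dense.eq_zero_of_inner_right (𝕜 := ℂ) fun η hη => h (⟨η, hη⟩, ξ)

/-- The operators `π (a) ⊗ π' (b)` on the algebraic tensor product of the domains. -/
noncomputable def tensorOp (ρ : Q.StarRep H) (ρ' : R.StarRep K) :
    A ⊗[ℂ] B →ₗ[ℂ] ρ.D ⊗[ℂ] ρ'.D →ₗ[ℂ] H ⊗[ℂ] K :=
  TensorProduct.map₂ ρ.op ρ'.op

variable (ρ : Q.StarRep H) (ρ' : R.StarRep K)

theorem inner_tensorOp_star (c : A ⊗[ℂ] B) (η ξ : ρ.D ⊗[ℂ] ρ'.D) :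
    ⟪tensorOp ρ ρ' (star c) η, TensorProduct.map ρ.D.subtype ρ'.D.subtype ξ⟫_ℂ =
      ⟪TensorProduct.map ρ.D.subtype ρ'.D.subtype η, tensorOp ρ ρ' c ξ⟫_ℂ := by
  induction c using TensorProduct.induction_on with
  | zero => simp
  | add c₁ c₂ h₁ h₂ =>
    simp only [star_add, map_add, LinearMap.add_apply, inner_add_left, inner_add_right, h₁, h₂]
  | tmul a b =>
    induction η using TensorProduct.induction_on with
    | zero => simp
    | add η₁ η₂ h₁ h₂ => simp only [map_add, inner_add_left, h₁, h₂]
    | tmul η η' =>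
      induction ξ using TensorProduct.induction_on with
      | zero => simp
      | add ξ₁ ξ₂ h₁ h₂ => simp only [map_add, inner_add_right, h₁, h₂]
      | tmul ξ ξ' => simp [tensorOp, inner_op_star]

theorem inner_tensorOp_star_tensorOp (c : A ⊗[ℂ] B) (z : A₀ ⊗[ℂ] B₀) (η ξ : ρ.D ⊗[ℂ] ρ'.D) :
    ⟪tensorOp ρ ρ' (star c) η, tensorOp ρ ρ' ((Q.tensor R).incl z) ξ⟫_ℂ =
      ⟪TensorProduct.map ρ.D.subtype ρ'.D.subtype η,
        tensorOp ρ ρ' ((Q.tensor R).rmul c z) ξ⟫_ℂ := by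
  induction c using TensorProduct.induction_on with
  | zero => simp
  | add c₁ c₂ h₁ h₂ =>
    simp only [star_add, map_add, LinearMap.add_apply, inner_add_left, inner_add_right, h₁, h₂]
  | tmul a b =>
    induction z using TensorProduct.induction_on with
    | zero => simp
    | add z₁ z₂ h₁ h₂ => simp only [map_add, LinearMap.add_apply, inner_add_right, h₁, h₂]
    | tmul x y =>
      induction η using TensorProduct.induction_on with
      | zero => simp
      | add η₁ η₂ h₁ h₂ => simp only [map_add, inner_add_left, h₁, h₂]
      | tmul η η' =>
        induction ξ using TensorProduct.induction_on with
        | zero => simp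
        | add ξ₁ ξ₂ h₁ h₂ => simp only [map_add, inner_add_right, h₁, h₂]
        | tmul ξ ξ' => simp [tensorOp, QuasiStarAlgebra.tensor, inner_op_star_op]

theorem inner_tensorOp_tmul (c : A ⊗[ℂ] B) (η ξ : ρ.D) (η' ξ' : ρ'.D) :
    ⟪TensorProduct.map ρ.D.subtype ρ'.D.subtype (η ⊗ₜ η'), tensorOp ρ ρ' c (ξ ⊗ₜ ξ')⟫_ℂ =
      LinearMap.mul' ℂ ℂ (TensorProduct.map (ρ.coeff η ξ) (ρ'.coeff η' ξ') c) := by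
  induction c using TensorProduct.induction_on with
  | zero => simp
  | add c₁ c₂ h₁ h₂ => simp only [map_add, LinearMap.add_apply, inner_add_right, h₁, h₂]
  | tmul a b => simp [tensorOp, coeff_apply]

theorem tensorOp_incl_identity {e : A₀} {f : B₀} (he : Q.IsIdentity e) (hf : R.IsIdentity f) :
    tensorOp ρ ρ' ((Q.tensor R).incl (e ⊗ₜ f)) = TensorProduct.map ρ.D.subtype ρ'.D.subtype := by
  have h : ρ.op (Q.incl e) = ρ.D.subtype := ρ.map_identity e he
  have h' : ρ'.op (R.incl f) = ρ'.D.subtype := ρ'.map_identity f hf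
  ext ξ ξ'
  simp [tensorOp, QuasiStarAlgebra.tensor, h, h']

variable {ρ ρ'}

theorem eq_zero_of_tensorOp_eq_zero (hρ : ρ.IsFaithful) (hρ' : ρ'.IsFaithful) (c : A ⊗[ℂ] B)
    (hc : tensorOp ρ ρ' c = 0) : c = 0 := by
  refine TensorProduct.eq_zero_of_separating (fun i : ρ.D × ρ.D => ρ.coeff i.1 i.2)
    (fun k : ρ'.D × ρ'.D => ρ'.coeff k.1 k.2) hρ.eq_zero_of_coeff hρ'.eq_zero_of_coeff c
    fun i k => ?_
  rw [← inner_tensorOp_tmul, hc]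
  simp

end StarRep

end Rep

/-! ### Continuity for the cross-norm and the two implications -/

section Normed

variable {A : Type u} {A₀ : Type u₀} {B : Type v} {B₀ : Type v₀}
  [NormedAddCommGroup A] [NormedSpace ℂ A] [StarAddMonoid A] [StarModule ℂ A]
  [NonUnitalRing A₀] [Module ℂ A₀] [IsScalarTower ℂ A₀ A₀] [SMulCommClass ℂ A₀ A₀]
  [StarRing A₀] [StarModule ℂ A₀]
  [NormedAddCommGroup B] [NormedSpace ℂ B] [StarAddMonoid B] [StarModule ℂ B]
  [NonUnitalRing B₀] [Module ℂ B₀] [IsScalarTower ℂ B₀ B₀] [SMulCommClass ℂ B₀ B₀]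
  [StarRing B₀] [StarModule ℂ B₀]
  {Q : QuasiStarAlgebra A A₀} {R : QuasiStarAlgebra B B₀}
  {H : Type w} [NormedAddCommGroup H] [InnerProductSpace ℂ H] [CompleteSpace H]
  {K : Type w} [NormedAddCommGroup K] [InnerProductSpace ℂ K] [CompleteSpace K]

/-- The matrix coefficients of a continuous *-representation are bounded. -/
theorem StarRep.IsStrongStarContinuous.exists_coeff_eq {ρ : Q.StarRep H}
    (hc : ρ.IsStrongStarContinuous (normSeminorm ℂ A)) (η ξ : ρ.D) :
    ∃ f : A →L[ℂ] ℂ, f.toLinearMap = ρ.coeff η ξ := by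
  obtain ⟨C, -, h⟩ := (ρ.isStrongStarContinuous_iff _).1 hc ξ
  refine ⟨(ρ.coeff η ξ).mkContinuous (‖(η : H)‖ * C) fun a => ?_, rfl⟩
  rw [StarRep.coeff_apply, mul_assoc]
  exact (norm_inner_le_norm _ _).trans (mul_le_mul_of_nonneg_left (h a).1 (norm_nonneg _))

/-- Each coefficient is a finite sum of functionals `f ⊗ g` with `f` and `g` bounded. The constant
depends on both `η` and `ξ`, so this is only weak boundedness. -/
theorem exists_bound_inner_tensorOp [Nontrivial A] [Nontrivial B] {n : Seminorm ℂ (A ⊗[ℂ] B)}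
    (hn : IsUniformCrossNorm n) {ρ : Q.StarRep H} {ρ' : R.StarRep K}
    (hc : ρ.IsStrongStarContinuous (normSeminorm ℂ A))
    (hc' : ρ'.IsStrongStarContinuous (normSeminorm ℂ B)) (η ξ : ρ.D ⊗[ℂ] ρ'.D) :
    ∃ C : ℝ, ∀ c, ‖⟪TensorProduct.map ρ.D.subtype ρ'.D.subtype η,
      StarRep.tensorOp ρ ρ' c ξ⟫_ℂ‖ ≤ C * n c := by
  induction η using TensorProduct.induction_on with
  | zero => exact ⟨0, fun c => by simp⟩
  | add η₁ η₂ h₁ h₂ =>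
    obtain ⟨C₁, h₁⟩ := h₁
    obtain ⟨C₂, h₂⟩ := h₂
    refine ⟨C₁ + C₂, fun c => ?_⟩
    rw [map_add, inner_add_left, add_mul]
    exact (norm_add_le _ _).trans (add_le_add (h₁ c) (h₂ c))
  | tmul η η' =>
    induction ξ using TensorProduct.induction_on with
    | zero => exact ⟨0, fun c => by simp⟩
    | add ξ₁ ξ₂ h₁ h₂ =>
      obtain ⟨C₁, h₁⟩ := h₁
      obtain ⟨C₂, h₂⟩ := h₂
      refine ⟨C₁ + C₂, fun c => ?_⟩
      rw [map_add, inner_add_right, add_mul]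
      exact (norm_add_le _ _).trans (add_le_add (h₁ c) (h₂ c))
    | tmul ξ ξ' =>
      obtain ⟨f, hf⟩ := hc.exists_coeff_eq η ξ
      obtain ⟨g, hg⟩ := hc'.exists_coeff_eq η' ξ'
      obtain ⟨C, h⟩ := hn.exists_bound f g
      refine ⟨C, fun c => ?_⟩
      rw [StarRep.inner_tensorOp_tmul, ← hf, ← hg]
      exact h c

theorem HasFaithfulContinuousStarRep.tensor [Nontrivial A] [Nontrivial B] {e : A₀} {f : B₀}
    (he : Q.IsIdentity e) (hf : R.IsIdentity f) {n : Seminorm ℂ (A ⊗[ℂ] B)}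
    (hn : IsUniformCrossNorm n) (hb : @BarrelledSpace ℂ (A ⊗[ℂ] B) _ _ _ n.normTopology)
    (hQ : HasFaithfulContinuousStarRep.{u, w, u₀} Q (normSeminorm ℂ A))
    (hR : HasFaithfulContinuousStarRep.{v, w, v₀} R (normSeminorm ℂ B)) :
    HasFaithfulContinuousStarRep.{max u v, w, max u₀ v₀} (Q.tensor R) n := by
  obtain ⟨H, _, _, _, ρ, hρ, hc⟩ := hQ
  obtain ⟨K, _, _, _, ρ', hρ', hc'⟩ := hR
  let ι : H ⊗[ℂ] K →ₗ[ℂ] UniformSpace.Completion (H ⊗[ℂ] K) :=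
    (UniformSpace.Completion.toComplₗᵢ (𝕜 := ℂ)).toLinearMap
  have hι : Function.Injective ι := (UniformSpace.Completion.toComplₗᵢ (𝕜 := ℂ)).injective
  have hin : ∀ s t, ⟪ι s, ι t⟫_ℂ = ⟪s, t⟫_ℂ := UniformSpace.Completion.inner_coe
  let J := TensorProduct.map ρ.D.subtype ρ'.D.subtype
  have hJ : Function.Injective J := TensorProduct.map_injective_of_flat_flat _ _
    ρ.D.injective_subtype ρ'.D.injective_subtype
  let T : A ⊗[ℂ] B →ₗ[ℂ] ρ.D ⊗[ℂ] ρ'.D →ₗ[ℂ] UniformSpace.Completion (H ⊗[ℂ] K) :=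
    (LinearMap.llcomp ℂ _ _ _ ι).comp (StarRep.tensorOp ρ ρ')
  have hT : ∀ c ξ, T c ξ = ι (StarRep.tensorOp ρ ρ' c ξ) := fun _ _ => rfl
  have hd : DenseRange (ι.comp J) := denseRange_toCompl_map_subtype ρ.dense ρ'.dense
  refine HasFaithfulContinuousStarRep.of_core (Q.tensor R) n (ι.comp J) (hι.comp hJ) hd T
    (fun c η ξ => ?_) (fun c z η ξ => ?_) (fun z hz => ?_) (fun c h0 => ?_) (fun ξ => ?_)
  · rw [hT, hT, LinearMap.comp_apply, LinearMap.comp_apply, hin, hin,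
      StarRep.inner_tensorOp_star]
  · rw [hT, hT, hT, LinearMap.comp_apply, hin, hin, StarRep.inner_tensorOp_star_tensorOp]
  -- The axiom quantifies over all identities; uniqueness leaves only `e ⊗ f`.
  · rw [hz.unique (he.tensor hf)]
    exact congrArg ι.comp (StarRep.tensorOp_incl_identity ρ ρ' he hf)
  · refine StarRep.eq_zero_of_tensorOp_eq_zero hρ hρ' c (LinearMap.ext fun ξ => hι ?_)
    rw [← hT, h0]
    simp
  · obtain ⟨C₁, h₁, hC₁⟩ := exists_bound_of_barrelled n hb (T.flip ξ) hd (by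
      rintro _ ⟨η, rfl⟩
      obtain ⟨C, h⟩ := exists_bound_inner_tensorOp hn hc hc' η ξ
      refine ⟨C, fun c => ?_⟩
      rw [LinearMap.flip_apply, hT, LinearMap.comp_apply, hin]
      exact h c)
    -- No bound on the involution with respect to `n` is available, so `c ↦ π(c*) ξ` needs a second
    -- barrelledness argument. The map is conjugate-linear, which is why the criterion allows
    -- semilinear maps.
    let S : A ⊗[ℂ] B →ₗ⋆[ℂ] UniformSpace.Completion (H ⊗[ℂ] K) :=
      { toFun := fun c => T (star c) ξ
        map_add' := fun c d => by simp
        map_smul' := fun z c => by simp }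
    obtain ⟨C₂, h₂, hC₂⟩ := exists_bound_of_barrelled n hb S hd (by
      rintro _ ⟨η, rfl⟩
      -- The roles of `ξ` and `η` are exchanged: `⟪η, π(c*) ξ⟫` is the conjugate of `⟪ξ, π(c) η⟫`.
      obtain ⟨C, h⟩ := exists_bound_inner_tensorOp hn hc hc' ξ η
      refine ⟨C, fun c => ?_⟩
      change ‖⟪ι (J η), ι (StarRep.tensorOp ρ ρ' (star c) ξ)⟫_ℂ‖ ≤ _
      rw [hin]
      refine (norm_inner_symm (𝕜 := ℂ) (E := H ⊗[ℂ] K) _ _).trans_le ?_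
      rw [StarRep.inner_tensorOp_star]
      exact h c)
    refine ⟨max C₁ C₂, h₁.trans (le_max_left _ _), fun c => ⟨(hC₁ c).trans ?_, (hC₂ c).trans ?_⟩⟩
    · exact mul_le_mul_of_nonneg_right (le_max_left _ _) (apply_nonneg n c)
    · exact mul_le_mul_of_nonneg_right (le_max_right _ _) (apply_nonneg n c)

/-- The map `a ↦ a ⊗ f` respects products and involution because `f` is idempotent and self-adjoint,
and it multiplies norms by `‖f‖`. -/
theorem HasFaithfulContinuousStarRep.of_tensor_left [Nontrivial B] {f : B₀} (hf : R.IsIdentity f)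
    {n : Seminorm ℂ (A ⊗[ℂ] B)} (hn : IsUniformCrossNorm n)
    (h : HasFaithfulContinuousStarRep.{max u v, w, max u₀ v₀} (Q.tensor R) n) :
    HasFaithfulContinuousStarRep.{u, w, u₀} Q (normSeminorm ℂ A) := by
  refine h.comp ((TensorProduct.mk ℂ A B).flip (R.incl f)) (fun x => x ⊗ₜ f) (fun a => ?_)
    (fun x => ?_) (fun a x => ?_) (fun e he => he.tensor hf) (fun a ha => ?_)
    (M := ‖R.incl f‖) (fun a => ?_)
  · simp [R.star_incl, hf.star_eq]
  · simp [QuasiStarAlgebra.tensor]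
  · simp [QuasiStarAlgebra.tensor, (hf _).1]
  · exact hn.tmul_ne_zero ha hf.incl_ne_zero
  · simp [hn.cross, mul_comm]

theorem HasFaithfulContinuousStarRep.of_tensor_right [Nontrivial A] {e : A₀} (he : Q.IsIdentity e)
    {n : Seminorm ℂ (A ⊗[ℂ] B)} (hn : IsUniformCrossNorm n)
    (h : HasFaithfulContinuousStarRep.{max u v, w, max u₀ v₀} (Q.tensor R) n) :
    HasFaithfulContinuousStarRep.{v, w, v₀} R (normSeminorm ℂ B) := by
  refine h.comp (TensorProduct.mk ℂ A B (Q.incl e)) (fun y => e ⊗ₜ y) (fun a => ?_)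
    (fun x => ?_) (fun a x => ?_) (fun f hf => he.tensor hf) (fun a ha => ?_)
    (M := ‖Q.incl e‖) (fun a => ?_)
  · simp [Q.star_incl, he.star_eq]
  · simp [QuasiStarAlgebra.tensor]
  · simp [QuasiStarAlgebra.tensor, (he _).1]
  · exact hn.tmul_ne_zero he.incl_ne_zero ha
  · simp [hn.cross]

end Normed

end QuasiStarAlgebra

theorem mainTheorem5
    {A : Type u} {A₀ : Type u₀} {B : Type v} {B₀ : Type v₀}
    [NormedAddCommGroup A] [NormedSpace ℂ A] [StarAddMonoid A] [StarModule ℂ A]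
    [NonUnitalRing A₀] [Module ℂ A₀] [IsScalarTower ℂ A₀ A₀] [SMulCommClass ℂ A₀ A₀]
    [StarRing A₀] [StarModule ℂ A₀]
    [NormedAddCommGroup B] [NormedSpace ℂ B] [StarAddMonoid B] [StarModule ℂ B]
    [NonUnitalRing B₀] [Module ℂ B₀] [IsScalarTower ℂ B₀ B₀] [SMulCommClass ℂ B₀ B₀]
    [StarRing B₀] [StarModule ℂ B₀]
    [Nontrivial A] [Nontrivial B]
    (Q : QuasiStarAlgebra A A₀) (R : QuasiStarAlgebra B B₀)
    (hQ : Q.IsBanach) (hR : R.IsBanach) (hQ1 : Q.IsUnital) (hR1 : R.IsUnital)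
    (n : Seminorm ℂ (A ⊗[ℂ] B)) (hn : IsUniformCrossNorm n) :
    ((Q.tensor R).HasFaithfulContinuousStarRep.{max u v, w, max u₀ v₀} n →
      Q.HasFaithfulContinuousStarRep.{u, w, u₀} (normSeminorm ℂ A) ∧
        R.HasFaithfulContinuousStarRep.{v, w, v₀} (normSeminorm ℂ B)) ∧
    (@BarrelledSpace ℂ (A ⊗[ℂ] B) _ _ _ n.normTopology →
      Q.HasFaithfulContinuousStarRep.{u, w, u₀} (normSeminorm ℂ A) ∧
        R.HasFaithfulContinuousStarRep.{v, w, v₀} (normSeminorm ℂ B) →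
      (Q.tensor R).HasFaithfulContinuousStarRep.{max u v, w, max u₀ v₀} n) := by
  obtain ⟨e, he, -⟩ := hQ1
  obtain ⟨f, hf, -⟩ := hR1
  exact ⟨fun h => ⟨h.of_tensor_left hf hn, h.of_tensor_right he hn⟩,
    fun hb h => .tensor he hf hn hb h.1 h.2⟩
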